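/- Let $h:\mathbb{C}\to\mathbb{C}$ be a real-affine mapping that is orientation preserving and not conformal, i.e. $h(z)=az+b\bar z+e$ with $a,b,e\in\mathbb{C}$ and $0<|b|<|a|$, and let $c\in\mathbb{C}$. Then the mapping $f:\mathbb{C}\to\mathbb{C}$, $f(z)=h(z)^2+c$, is quasiregular but not uniformly quasiregular. Here a continuous mapping $g:\mathbb{C}\to\mathbb{C}$ is quasiregular if $g\in W^{1,2}_{\mathrm{loc}}(\mathbb{C})$ and there is $K\in[1,\infty)$ with $|g'(z)|^2\le K J_g(z)$ for almost every $z$, where $|g'(z)|$ is the operator norm of the weak derivative $g'(z)$ and $J_g(z)$ is its determinant. It is $K$-quasiregular if this inequality and $J_g(z)\le K\inf_{|v|=1}|g'(z)v|^2$ both hold for almost every $z$. The mapping $f$ is uniformly quasiregular if there is a single $K\in[1,\infty)$ such that every iterate $f^n$, $n\ge 1$, is $K$-quasiregular. -/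

import Mathlib

open MeasureTheory
open scoped ContDiff

/-- `u` is locally square integrable on `G`: it is in `L²` of every compact subset of `G`. -/
def IsLocallyL2On {E : Type*} [NormedAddCommGroup E] (u : ℂ → E) (G : Set ℂ) : Prop :=
  ∀ S : Set ℂ, S ⊆ G → IsCompact S → MemLp u 2 (volume.restrict S)

/-- `D` is the weak (distributional) real derivative of `f` on `G`, tested against smooth real
functions with compact support in `G`: for every direction `v`,
`∫ (∂_v φ) f = - ∫ φ (D v)`. -/
def IsWeakDerivOn (f : ℂ → ℂ) (D : ℂ → ℂ →L[ℝ] ℂ) (G : Set ℂ) : Prop :=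
  ∀ φ : ℂ → ℝ, ContDiff ℝ ∞ φ → HasCompactSupport φ → tsupport φ ⊆ G →
    ∀ v : ℂ, ∫ z, fderiv ℝ φ z v • f z = - ∫ z, φ z • D z v

/-- `f` lies in the local Sobolev space `W^{1,2}_loc(G)`, and `D` is (a representative of) its
weak derivative. -/
structure IsSobolevDerivOn (f : ℂ → ℂ) (D : ℂ → ℂ →L[ℝ] ℂ) (G : Set ℂ) : Prop where
  locallyL2 : IsLocallyL2On f G
  locallyL2_deriv : IsLocallyL2On D G
  weakDeriv : IsWeakDerivOn f D G

/-- `f` is quasiregular on the planar domain `G`: it is continuous, belongs to `W^{1,2}_loc(G)`,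
and for some `K ∈ [1, ∞)` one has `|f'(z)|² ≤ K J_f(z)` for almost every `z ∈ G`. -/
def IsQuasiregularOn (f : ℂ → ℂ) (G : Set ℂ) : Prop :=
  IsOpen G ∧ IsConnected G ∧ ContinuousOn f G ∧
    ∃ D : ℂ → ℂ →L[ℝ] ℂ, IsSobolevDerivOn f D G ∧
      ∃ K : ℝ, 1 ≤ K ∧ ∀ᵐ z ∂(volume.restrict G), ‖D z‖ ^ 2 ≤ K * (D z).det

/-- `f` is `K`-quasiregular on the planar domain `G`: it is quasiregular there with outer
distortion (`|f'|² ≤ K J_f` a.e.) and inner distortion (`J_f ≤ K inf_{|v| = 1} |f' v|²` a.e.)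
both at most `K`, i.e. with maximal distortion at most `K`. -/
def IsKQuasiregularOn (K : ℝ) (f : ℂ → ℂ) (G : Set ℂ) : Prop :=
  1 ≤ K ∧ IsOpen G ∧ IsConnected G ∧ ContinuousOn f G ∧
    ∃ D : ℂ → ℂ →L[ℝ] ℂ, IsSobolevDerivOn f D G ∧
      (∀ᵐ z ∂(volume.restrict G), ‖D z‖ ^ 2 ≤ K * (D z).det) ∧
      (∀ᵐ z ∂(volume.restrict G), ∀ v : ℂ, ‖v‖ = 1 → (D z).det ≤ K * ‖D z v‖ ^ 2)

/-- `f : ℂ → ℂ` is uniformly quasiregular: the iterates of `f` are all quasiregular, with a common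
bound on their maximal distortions. -/
def IsUniformlyQuasiregular (f : ℂ → ℂ) : Prop :=
  ∃ K : ℝ, ∀ n : ℕ, 1 ≤ n → IsKQuasiregularOn K (f^[n]) Set.univ

/-! The derivative of `f z = (L z + e) ^ 2 + c`, with `L` real-linear, is `2 (L z + e) • L`: the
constant linear map `L` followed by multiplication by a complex number. Such a multiplication does
not change the distortion, so `f` is quasiregular with the distortion of `L`.

The derivative of `f^[n]` at `z` is a product of such maps, and only the arguments of the numbers
`L z_j + e` along the orbit matter for its distortion. On the circle of directions at infinity `f`
acts by `w ↦ (L w)² / |L w|²`, a map that has a fixed point `w = p²`, found by the intermediate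
value theorem (`exists_unit_apply_sq_eq_smul`); it satisfies `L (p²) = t p` with `t` real. If `z`
goes to infinity along the ray through `p²`, the first `n` points of its orbit become tangent to
that ray, and the derivative of `f^[n]`, rescaled by real numbers, tends to a multiple of
`(p • L) ^ n` (`exists_tendsto_iterate_affine_sq`). Maps of distortion at most `K` form a closed
cone, so a common bound for the iterates would bound the distortion of all powers of `p • L`. But
`p • L` has the real eigenvector `p²`, and a linear map of the plane with a real eigenvector and
powers of bounded distortion is a scalar (`eq_smul_of_forall_pow_mem_distortionCone`). Then `L`
would be multiplication by a complex number.

The distortion inequality, which is assumed for some weak derivative and almost everywhere, holds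
for the classical derivative and at every point, as weak derivatives are unique and the iterates
are smooth (`IsKQuasiregularOn.fderiv_mem_distortionCone`). -/

/-! ### Linear distortion of real-linear maps of the plane -/

/-- The real-linear maps `A` of the plane with `‖A‖² ≤ K det A`. For `K ≥ 1` these are zero and the
orientation preserving maps with linear distortion at most `K`. -/
def distortionCone (K : ℝ) : Set (ℂ →L[ℝ] ℂ) :=
  {A | ‖A‖ ^ 2 ≤ K * A.det}

theorem isClosed_distortionCone (K : ℝ) : IsClosed (distortionCone K) :=
  isClosed_le (continuous_norm.pow 2)
    (continuous_const.mul ContinuousLinearMap.continuous_det)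

theorem det_real_smul (c : ℝ) (A : ℂ →L[ℝ] ℂ) : (c • A).det = c ^ 2 * A.det := by
  simp [ContinuousLinearMap.det, LinearMap.det_smul, Complex.finrank_real_complex]

theorem smul_mem_distortionCone {K : ℝ} {A : ℂ →L[ℝ] ℂ} (hA : A ∈ distortionCone K) (c : ℝ) :
    c • A ∈ distortionCone K := by
  have h : ‖A‖ ^ 2 ≤ K * A.det := hA
  change ‖c • A‖ ^ 2 ≤ K * (c • A).det
  rw [det_real_smul, norm_smul, mul_pow, Real.norm_eq_abs, sq_abs]
  nlinarith [mul_le_mul_of_nonneg_left h (sq_nonneg c)]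

theorem mem_distortionCone_of_real_smul {K c : ℝ} (hc : c ≠ 0) {A : ℂ →L[ℝ] ℂ}
    (hA : c • A ∈ distortionCone K) : A ∈ distortionCone K := by
  simpa [smul_smul, hc] using smul_mem_distortionCone hA c⁻¹

theorem det_complex_smul (c : ℂ) (A : ℂ →L[ℝ] ℂ) : (c • A).det = ‖c‖ ^ 2 * A.det := by
  have h : ((c • A : ℂ →L[ℝ] ℂ) : ℂ →ₗ[ℝ] ℂ) =
      LinearMap.mulLeft ℝ c ∘ₗ (A : ℂ →ₗ[ℝ] ℂ) := by
    ext
    simp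
  have h' : LinearMap.det (LinearMap.mulLeft ℝ c) = ‖c‖ ^ 2 := by
    rw [← Complex.normSq_eq_norm_sq, ← Algebra.norm_complex_apply, Algebra.norm_apply]
    rfl
  rw [ContinuousLinearMap.det, h, LinearMap.det_comp, h', ContinuousLinearMap.det]

theorem apply_eq_re_smul_add_im_smul (A : ℂ →L[ℝ] ℂ) (u : ℂ) :
    A u = u.re • A 1 + u.im • A Complex.I := by
  rw [← map_smul, ← map_smul, ← map_add]
  congr 1
  apply Complex.ext <;> simp

theorem det_eq_re_mul_im_sub (A : ℂ →L[ℝ] ℂ) :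
    A.det = (A 1).re * (A Complex.I).im - (A Complex.I).re * (A 1).im := by
  rw [ContinuousLinearMap.det, ← LinearMap.det_toMatrix Complex.basisOneI, Matrix.det_fin_two]
  simp [LinearMap.toMatrix_apply]

/-- In the basis `w`, `iw` the map is upper triangular with diagonal entries `t` and `m`. -/
theorem det_of_apply_eq_smul {A : ℂ →L[ℝ] ℂ} {w : ℂ} (hw : ‖w‖ = 1) {t x m : ℝ}
    (h₁ : A w = t • w) (h₂ : A (Complex.I * w) = x • w + m • (Complex.I * w)) :
    A.det = t * m := by
  have hw' : w.re ^ 2 + w.im ^ 2 = 1 := by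
    have := Complex.sq_norm w
    rw [hw, Complex.normSq_apply] at this
    linarith
  rw [apply_eq_re_smul_add_im_smul] at h₁ h₂
  have e₁ := congrArg Complex.re h₁
  have e₂ := congrArg Complex.im h₁
  have e₃ := congrArg Complex.re h₂
  have e₄ := congrArg Complex.im h₂
  simp at e₁ e₂ e₃ e₄
  rw [det_eq_re_mul_im_sub]
  -- The area form: `det A` times the area of `(w, iw)` is the area of `(A w, A (iw))`.
  have key : ((A 1).re * (A Complex.I).im - (A Complex.I).re * (A 1).im) *
      (w.re ^ 2 + w.im ^ 2) = t * m * (w.re ^ 2 + w.im ^ 2) := by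
    calc _ = (w.re * (A 1).re + w.im * (A Complex.I).re) *
          (-(w.im * (A 1).im) + w.re * (A Complex.I).im) -
        (-(w.im * (A 1).re) + w.re * (A Complex.I).re) *
          (w.re * (A 1).im + w.im * (A Complex.I).im) := by ring
      _ = _ := by rw [e₁, e₂, e₃, e₄]; ring
  simpa [hw'] using key

theorem pow_succ_apply (A : ℂ →L[ℝ] ℂ) (n : ℕ) (v : ℂ) : (A ^ (n + 1)) v = A ((A ^ n) v) := by
  rw [pow_succ']
  rfl

theorem pow_apply_eigenvector {A : ℂ →L[ℝ] ℂ} {w : ℂ} {t : ℝ} (h : A w = t • w) (n : ℕ) :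
    (A ^ n) w = t ^ n • w := by
  induction n with
  | zero => simp
  | succ n ih => rw [pow_succ_apply, ih, map_smul, h, smul_smul, pow_succ]

theorem det_pow (A : ℂ →L[ℝ] ℂ) (n : ℕ) : (A ^ n).det = A.det ^ n := by
  induction n with
  | zero => simp [ContinuousLinearMap.det]
  | succ n ih =>
    rw [pow_succ, pow_succ, ← ih]
    exact LinearMap.det_comp _ _

theorem sq_norm_apply_le {K : ℝ} {A : ℂ →L[ℝ] ℂ} (hA : A ∈ distortionCone K) {v : ℂ}
    (hv : ‖v‖ = 1) : ‖A v‖ ^ 2 ≤ K * A.det := by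
  have h : ‖A v‖ ≤ ‖A‖ := by simpa [hv] using A.le_opNorm v
  exact (pow_le_pow_left₀ (norm_nonneg _) h 2).trans hA

/-- A geometric sequence that is bounded by a constant multiple of another has the smaller
ratio. -/
theorem le_of_forall_pow_le_mul_pow {a b C : ℝ} (hb : 0 < b)
    (h : ∀ n : ℕ, a ^ n ≤ C * b ^ n) : a ≤ b := by
  by_contra! hlt
  obtain ⟨n, hn⟩ := pow_unbounded_of_one_lt C ((one_lt_div hb).2 hlt)
  rw [div_pow, lt_div_iff₀ (pow_pos hb n)] at hn
  exact absurd (h n) (not_le.2 hn)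

/-- If all powers of `A` have uniformly bounded distortion and `A` has a real eigenvector, then `A`
is a scalar: distinct eigenvalues make the distortion of `A ^ n` grow geometrically, and a
nontrivial Jordan block makes it grow quadratically. -/
theorem eq_smul_of_forall_pow_mem_distortionCone {K : ℝ} {A : ℂ →L[ℝ] ℂ} {w : ℂ} {t : ℝ}
    (hdet : 0 < A.det) (hw : ‖w‖ = 1) (h₁ : A w = t • w)
    (hA : ∀ n : ℕ, A ^ n ∈ distortionCone K) (z : ℂ) : A z = t • z := by
  have hw0 : w ≠ 0 := by rintro rfl; simp at hw
  have hIw : ‖Complex.I * w‖ = 1 := by simp [hw]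
  have decomp (v : ℂ) : v = (v / w).re • w + (v / w).im • (Complex.I * w) := by
    calc v = (v / w) * w := by field_simp
      _ = (((v / w).re : ℂ) + (v / w).im * Complex.I) * w := by rw [Complex.re_add_im]
      _ = _ := by simp only [Complex.real_smul]; ring
  -- `A` is upper triangular in the basis `w`, `iw`.
  obtain ⟨x, m, h₂⟩ : ∃ x m : ℝ, A (Complex.I * w) = x • w + m • (Complex.I * w) :=
    ⟨_, _, decomp _⟩
  have hd := det_of_apply_eq_smul hw h₁ h₂
  have coord (r s : ℝ) : ‖r • w + s • (Complex.I * w)‖ ^ 2 = r ^ 2 + s ^ 2 := by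
    have : r • w + s • (Complex.I * w) = (r + s * Complex.I) * w := by
      simp only [Complex.real_smul]; ring
    rw [this, norm_mul, hw, mul_one, Complex.sq_norm, Complex.normSq_add_mul_I]
  have hpos : 0 < t * m := hd ▸ hdet
  have ht : t ^ 2 ≤ t * m := by
    refine le_of_forall_pow_le_mul_pow (C := K) hpos fun n => ?_
    have := sq_norm_apply_le (hA n) hw
    rw [pow_apply_eigenvector h₁, norm_smul, hw, det_pow, hd, mul_one, Real.norm_eq_abs,
      sq_abs] at this
    linarith [pow_right_comm t 2 n]
  have hIpow (n : ℕ) : ∃ y : ℝ, (A ^ n) (Complex.I * w) = y • w + m ^ n • (Complex.I * w) := by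
    induction n with
    | zero => exact ⟨0, by simp⟩
    | succ n ih =>
      obtain ⟨y, hy⟩ := ih
      refine ⟨y * t + m ^ n * x, ?_⟩
      rw [pow_succ_apply, hy, map_add, map_smul, map_smul, h₁, h₂, pow_succ]
      module
  have hm : m ^ 2 ≤ t * m := by
    refine le_of_forall_pow_le_mul_pow (C := K) hpos fun n => ?_
    obtain ⟨y, hy⟩ := hIpow n
    have := sq_norm_apply_le (hA n) hIw
    rw [hy, coord, det_pow, hd] at this
    nlinarith [pow_right_comm m 2 n, sq_nonneg y]
  have htm : m = t := by nlinarith [sq_nonneg (m - t)]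
  subst htm
  have hm0 : m ≠ 0 := by rintro rfl; simp at hpos
  -- The off-diagonal entry is `n m ^ (n - 1) x`; the factor `m` avoids the truncated subtraction.
  have hJordan (n : ℕ) :
      (A ^ n) (Complex.I * w) * m = (n * m ^ n * x) • w + m ^ (n + 1) • (Complex.I * w) := by
    induction n with
    | zero => simp; ring
    | succ n ih =>
      have hre (v : ℂ) : A v * m = A (v * m) := by
        rw [mul_comm, mul_comm v, ← Complex.real_smul, ← Complex.real_smul, map_smul]
      rw [pow_succ_apply, hre, ih, map_add, map_smul, map_smul, h₁, h₂, pow_succ _ (n + 1)]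
      push_cast
      module
  have hx : x = 0 := by
    by_contra hx
    obtain ⟨n, hn⟩ := exists_nat_gt (K * m ^ 2 / x ^ 2)
    have hx2 : 0 < x ^ 2 := by positivity
    have hm2 : 0 < (m ^ (n + 1)) ^ 2 := by positivity
    rw [div_lt_iff₀ hx2] at hn
    have h := sq_norm_apply_le (hA (n + 1)) hIw
    have hJ := congrArg (fun v : ℂ => ‖v‖ ^ 2) (hJordan (n + 1))
    rw [coord, norm_mul, mul_pow, Complex.norm_real, Real.norm_eq_abs, sq_abs] at hJ
    rw [det_pow, hd] at h
    have h' := mul_le_mul_of_nonneg_right h (sq_nonneg m)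
    rw [hJ] at h'
    have e : K * (m * m) ^ (n + 1) * m ^ 2 = (K * m ^ 2) * (m ^ (n + 1)) ^ 2 := by
      rw [mul_pow]; ring
    have e' : (((n + 1 : ℕ) : ℝ) * m ^ (n + 1) * x) ^ 2 =
        ((n : ℝ) + 1) ^ 2 * x ^ 2 * (m ^ (n + 1)) ^ 2 := by
      push_cast; ring
    rw [e, e'] at h'
    have h'' : ((n : ℝ) + 1) ^ 2 * x ^ 2 * (m ^ (n + 1)) ^ 2 ≤
        K * m ^ 2 * (m ^ (n + 1)) ^ 2 := by
      linarith [sq_nonneg (m ^ (n + 1 + 1))]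
    have h3 := le_of_mul_le_mul_right h'' hm2
    have hn0 : (0 : ℝ) ≤ n := n.cast_nonneg
    nlinarith [mul_nonneg hn0 hx2.le, mul_nonneg (mul_nonneg hn0 hn0) hx2.le]
  rw [hx, zero_smul, zero_add] at h₂
  conv_lhs => rw [decomp z]
  conv_rhs => rw [decomp z]
  rw [map_add, map_smul, map_smul, h₁, h₂]
  module

/-! ### Weak derivatives of smooth maps -/

theorem Continuous.isLocallyL2On {E : Type*} [NormedAddCommGroup E] {u : ℂ → E}
    [SecondCountableTopologyEither ℂ E] (hu : Continuous u) (G : Set ℂ) : IsLocallyL2On u G := by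
  intro S _ hS
  have : IsFiniteMeasure (volume.restrict S : Measure ℂ) := ⟨by simpa using hS.measure_lt_top⟩
  obtain ⟨C, hC⟩ := hS.exists_bound_of_continuousOn hu.continuousOn
  exact MemLp.of_bound hu.aestronglyMeasurable C
    ((ae_restrict_iff' hS.measurableSet).2 (Filter.Eventually.of_forall hC))

theorem ContDiff.isWeakDerivOn {f : ℂ → ℂ} (hf : ContDiff ℝ 1 f) (G : Set ℂ) :
    IsWeakDerivOn f (fderiv ℝ f) G := by
  intro φ hφ hc _ v
  have hφ' : Continuous fun z => fderiv ℝ φ z v :=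
    (hφ.continuous_fderiv (by simp)).clm_apply continuous_const
  have hf' : Continuous fun z => fderiv ℝ f z v :=
    (hf.continuous_fderiv (by simp)).clm_apply continuous_const
  have hc' : HasCompactSupport fun z => fderiv ℝ φ z v := hc.fderiv_apply ℝ v
  rw [integral_smul_fderiv_eq_neg_fderiv_smul_of_integrable (𝕜 := ℝ), neg_neg]
  · exact (hφ'.smul hf.continuous).integrable_of_hasCompactSupport hc'.smul_right
  · exact (hφ.continuous.smul hf').integrable_of_hasCompactSupport hc.smul_right
  · exact (hφ.continuous.smul hf.continuous).integrable_of_hasCompactSupport hc.smul_right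
  · exact fun z _ => (hφ.differentiable (by simp)) z
  · exact fun z _ => (hf.differentiable (by simp)) z

theorem ContDiff.isSobolevDerivOn {f : ℂ → ℂ} (hf : ContDiff ℝ 1 f) (G : Set ℂ) :
    IsSobolevDerivOn f (fderiv ℝ f) G where
  locallyL2 := hf.continuous.isLocallyL2On G
  locallyL2_deriv := (hf.continuous_fderiv (by simp)).isLocallyL2On G
  weakDeriv := hf.isWeakDerivOn G

theorem IsLocallyL2On.locallyIntegrable {E : Type*} [NormedAddCommGroup E] {u : ℂ → E}
    (hu : IsLocallyL2On u Set.univ) : LocallyIntegrable u := by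
  rw [locallyIntegrable_iff]
  intro S hS
  have : IsFiniteMeasure (volume.restrict S : Measure ℂ) := ⟨by simpa using hS.measure_lt_top⟩
  exact (hu S (Set.subset_univ S) hS).integrable (by norm_num)

theorem LocallyIntegrable.clm_apply_const {D : ℂ → ℂ →L[ℝ] ℂ} (hD : LocallyIntegrable D) (v : ℂ) :
    LocallyIntegrable fun z => D z v := by
  rw [locallyIntegrable_iff] at hD ⊢
  exact fun S hS => (hD S hS).apply_continuousLinearMap v

/-- The weak derivative is unique up to null sets. -/
theorem IsSobolevDerivOn.ae_eq {f : ℂ → ℂ} {D D' : ℂ → ℂ →L[ℝ] ℂ}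
    (h : IsSobolevDerivOn f D Set.univ) (h' : IsSobolevDerivOn f D' Set.univ) :
    ∀ᵐ z, D z = D' z := by
  have key (v : ℂ) : ∀ᵐ z, D z v = D' z v := by
    refine ae_eq_of_integral_contDiff_smul_eq
      (LocallyIntegrable.clm_apply_const h.locallyL2_deriv.locallyIntegrable v)
      (LocallyIntegrable.clm_apply_const h'.locallyL2_deriv.locallyIntegrable v) ?_
    intro φ hφ hc
    have e := h.weakDeriv φ hφ hc (Set.subset_univ _) v
    rw [h'.weakDeriv φ hφ hc (Set.subset_univ _) v] at e
    exact (neg_injective e).symm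
  filter_upwards [key 1, key Complex.I] with z h₁ h₂
  ext v
  rw [apply_eq_re_smul_add_im_smul, h₁, h₂, ← apply_eq_re_smul_add_im_smul]

/-- For a continuously differentiable map the distortion inequality holds everywhere, not only
almost everywhere. -/
theorem IsKQuasiregularOn.fderiv_mem_distortionCone {K : ℝ} {f : ℂ → ℂ}
    (h : IsKQuasiregularOn K f Set.univ) (hf : ContDiff ℝ 1 f) (z : ℂ) :
    fderiv ℝ f z ∈ distortionCone K := by
  obtain ⟨_, _, _, _, D, hD, hK, _⟩ := h
  rw [Measure.restrict_univ] at hK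
  have hae : ∀ᵐ z, fderiv ℝ f z ∈ distortionCone K := by
    filter_upwards [hK, hD.ae_eq (hf.isSobolevDerivOn Set.univ)] with z h₁ h₂
    rw [← h₂]
    exact h₁
  have hclosed : IsClosed {z | fderiv ℝ f z ∈ distortionCone K} :=
    (isClosed_distortionCone K).preimage (hf.continuous_fderiv (by simp))
  have : z ∈ closure {z | fderiv ℝ f z ∈ distortionCone K} := Measure.dense_of_ae hae z
  rwa [hclosed.closure_eq] at this

/-! ### The square of a real-affine map -/

/-- Writing `p = exp (iθ)`, the function `Im (L (p²) p⁻¹)` changes sign between `θ` and `θ + π`. -/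
theorem exists_unit_apply_sq_eq_smul (L : ℂ →L[ℝ] ℂ) :
    ∃ p : ℂ, ‖p‖ = 1 ∧ ∃ t : ℝ, L (p ^ 2) = t • p := by
  let e : ℝ → ℂ := fun θ => Complex.exp (θ * Complex.I)
  have he : Continuous e := by fun_prop
  let g : ℝ → ℝ := fun θ => (L (e θ ^ 2) * e (-θ)).im
  have hg : Continuous g := by fun_prop
  have hzero : e 0 = 1 := by simp [e]
  have hpi : e Real.pi = -1 := by simp [e]
  have hnegpi : e (-Real.pi) = -1 := by
    simp [e, Complex.exp_neg]
  have hg' : g Real.pi = -g 0 := by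
    simp [g, hzero, hpi, hnegpi]
  obtain ⟨θ, hθ⟩ : ∃ θ, g θ = 0 := by
    rcases le_total (g 0) 0 with h | h
    · exact mem_range_of_exists_le_of_exists_ge hg ⟨0, h⟩ ⟨Real.pi, by linarith⟩
    · exact mem_range_of_exists_le_of_exists_ge hg ⟨Real.pi, by linarith⟩ ⟨0, h⟩
  have hee : e (-θ) * e θ = 1 := by
    simp only [e, ← Complex.exp_add]
    simp
  refine ⟨e θ, by simp [e, Complex.norm_exp_ofReal_mul_I], (L (e θ ^ 2) * e (-θ)).re, ?_⟩
  have hreal : (((L (e θ ^ 2) * e (-θ)).re : ℝ) : ℂ) = L (e θ ^ 2) * e (-θ) := by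
    apply Complex.ext
    · simp
    · rw [Complex.ofReal_im]; exact hθ.symm
  rw [Complex.real_smul, hreal, mul_assoc, hee, mul_one]

theorem hasFDerivAt_affine_sq_add_const (L : ℂ →L[ℝ] ℂ) (e c z : ℂ) :
    HasFDerivAt (fun z => (L z + e) ^ 2 + c) ((2 * (L z + e)) • L) z := by
  have h := ((L.hasFDerivAt (x := z)).add_const e).pow 2 |>.add_const c
  refine h.congr_fderiv ?_
  change (2 • (L z + e) ^ 1) • L = _
  rw [pow_one, nsmul_eq_mul, Nat.cast_ofNat]

theorem contDiff_affine_sq_add_const (L : ℂ →L[ℝ] ℂ) (e c : ℂ) :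
    ContDiff ℝ 1 (fun z => (L z + e) ^ 2 + c) :=
  ((L.contDiff.add contDiff_const).pow 2).add contDiff_const

theorem isQuasiregularOn_affine_sq_add_const {L : ℂ →L[ℝ] ℂ} (hL : 0 < L.det) (e c : ℂ) :
    IsQuasiregularOn (fun z => (L z + e) ^ 2 + c) Set.univ := by
  have hf := contDiff_affine_sq_add_const L e c
  refine ⟨isOpen_univ, isConnected_univ, hf.continuous.continuousOn, _,
    hf.isSobolevDerivOn Set.univ, max 1 (‖L‖ ^ 2 / L.det), le_max_left _ _,
    Filter.Eventually.of_forall fun z => ?_⟩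
  rw [(hasFDerivAt_affine_sq_add_const L e c z).fderiv, det_complex_smul, norm_smul, mul_pow]
  have h : ‖L‖ ^ 2 ≤ max 1 (‖L‖ ^ 2 / L.det) * L.det :=
    (div_le_iff₀ hL).1 (le_max_right _ _)
  linarith [mul_le_mul_of_nonneg_left h (sq_nonneg ‖2 * (L z + e)‖)]

theorem ContDiff.iterate_complex {f : ℂ → ℂ} (hf : ContDiff ℝ 1 f) (n : ℕ) :
    ContDiff ℝ 1 (f^[n]) := by
  induction n with
  | zero => exact contDiff_id
  | succ n ih => rw [Function.iterate_succ']; exact hf.comp ih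

open Filter Topology in
/-- Along the ray through the fixed direction `p²` of the angular dynamics, the orbit stays
asymptotic to that ray, so every factor of the derivative of the iterate is asymptotically a real
multiple of `p • L`. -/
theorem exists_tendsto_iterate_affine_sq (L : ℂ →L[ℝ] ℂ) (e c p : ℂ) {t : ℝ} (ht : t ≠ 0)
    (hp : L (p ^ 2) = t • p) (n : ℕ) :
    (∃ s : ℝ, 0 < s ∧ Tendsto
      (fun R : ℝ => ((R ^ 2 ^ n)⁻¹ : ℝ) • (fun z => (L z + e) ^ 2 + c)^[n] (R • p ^ 2))
      atTop (𝓝 (s • p ^ 2))) ∧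
    ∃ k : ℝ, k ≠ 0 ∧ ∃ m : ℕ, Tendsto
      (fun R : ℝ => ((R ^ m)⁻¹ : ℝ) •
        fderiv ℝ ((fun z => (L z + e) ^ 2 + c)^[n]) (R • p ^ 2))
      atTop (𝓝 (k • (p • L) ^ n)) := by
  set f : ℂ → ℂ := fun z => (L z + e) ^ 2 + c
  induction n with
  | zero =>
    refine ⟨⟨1, one_pos, ?_⟩, 1, one_ne_zero, 0, ?_⟩
    · refine tendsto_const_nhds.congr' ?_
      filter_upwards [eventually_gt_atTop 0] with R hR
      simp [hR.ne']
    · refine tendsto_const_nhds.congr fun R => ?_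
      simp only [pow_zero, inv_one, one_smul, Function.iterate_zero, fderiv_id]
      rfl
  | succ n ih =>
    obtain ⟨⟨s, hs, hlim⟩, k, hk, m, hder⟩ := ih
    have hsmall (q : ℕ) (hq : q ≠ 0) (a : ℂ) :
        Tendsto (fun R : ℝ => ((R ^ q)⁻¹ : ℝ) • a) atTop (𝓝 0) := by
      simpa using ((tendsto_pow_atTop hq).inv_tendsto_atTop (𝕜 := ℝ)).smul_const a
    have hh : Tendsto (fun R : ℝ => ((R ^ 2 ^ n)⁻¹ : ℝ) • (L (f^[n] (R • p ^ 2)) + e)) atTop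
        (𝓝 ((s * t) • p)) := by
      have := ((L.continuous.tendsto _).comp hlim).add (hsmall (2 ^ n) (by positivity) e)
      rw [map_smul, hp, smul_smul, add_zero] at this
      refine this.congr fun R => ?_
      change L _ + _ = _
      rw [map_smul, smul_add]
    refine ⟨⟨(s * t) ^ 2, by positivity, ?_⟩, 2 * (s * t) * k, by positivity, m + 2 ^ n, ?_⟩
    · have := (hh.pow 2).add (hsmall (2 ^ (n + 1)) (by positivity) c)
      rw [add_zero, smul_pow] at this
      refine this.congr fun R => ?_
      rw [Function.iterate_succ_apply', smul_pow, inv_pow, ← pow_mul, ← pow_succ, ← smul_add]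
    · have h2 : Tendsto (fun R : ℝ =>
          (2 * (((R ^ 2 ^ n)⁻¹ : ℝ) • (L (f^[n] (R • p ^ 2)) + e))) • L) atTop
          (𝓝 ((2 * ((s * t) • p)) • L)) :=
        (hh.const_mul 2).smul_const L
      have h3 := h2.mul hder
      have hval : ((2 * ((s * t) • p)) • L) * (k • (p • L) ^ n) =
          (2 * (s * t) * k) • (p • L) ^ (n + 1) := by
        rw [pow_succ']
        ext v
        change (2 * ((s * t) • p)) * L (k • ((p • L) ^ n) v) =
          (2 * (s * t) * k) • (p * L (((p • L) ^ n) v))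
        rw [map_smul]
        simp only [Complex.real_smul]
        push_cast
        ring
      rw [hval] at h3
      refine h3.congr fun R => ?_
      have hd : DifferentiableAt ℝ (f^[n]) (R • p ^ 2) :=
        ((contDiff_affine_sq_add_const L e c).iterate_complex n).differentiable (by simp) _
      have hchain := ((hasFDerivAt_affine_sq_add_const L e c (f^[n] (R • p ^ 2))).comp _
        hd.hasFDerivAt).fderiv
      rw [Function.iterate_succ', hchain, pow_add, mul_inv]
      ext v
      change (2 * (((R ^ 2 ^ n)⁻¹ : ℝ) • (L (f^[n] (R • p ^ 2)) + e))) *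
          L (((R ^ m)⁻¹ : ℝ) • fderiv ℝ (f^[n]) (R • p ^ 2) v) =
        ((R ^ m)⁻¹ * (R ^ 2 ^ n)⁻¹ : ℝ) •
          (2 * (L (f^[n] (R • p ^ 2)) + e) * L (fderiv ℝ (f^[n]) (R • p ^ 2) v))
      rw [map_smul]
      simp only [Complex.real_smul]
      push_cast
      ring

theorem not_isUniformlyQuasiregular_affine_sq_add_const {L : ℂ →L[ℝ] ℂ} (hL : 0 < L.det)
    (hconf : ¬ ∃ a : ℂ, ∀ z, L z = a * z) (e c : ℂ) :
    ¬ IsUniformlyQuasiregular (fun z => (L z + e) ^ 2 + c) := by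
  rintro ⟨K, hK⟩
  obtain ⟨p, hp1, t, hp⟩ := exists_unit_apply_sq_eq_smul L
  have hp0 : p ≠ 0 := by rintro rfl; simp at hp1
  have ht : t ≠ 0 := by
    rintro rfl
    have hinj : Function.Injective L :=
      ((LinearMap.equivOfDetNeZero (L : ℂ →ₗ[ℝ] ℂ) hL.ne').injective)
    have : p ^ 2 = 0 := hinj (by rw [hp, zero_smul, map_zero])
    exact hp0 (pow_eq_zero_iff (two_ne_zero) |>.1 this)
  have hdet : (p • L).det = L.det := by rw [det_complex_smul, hp1]; ring
  have heig : (p • L) (p ^ 2) = t • p ^ 2 := by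
    simp [hp]; ring
  have hmem (n : ℕ) (hn : 1 ≤ n) : (p • L) ^ n ∈ distortionCone K := by
    obtain ⟨-, k, hk, m, hlim⟩ := exists_tendsto_iterate_affine_sq L e c p ht hp n
    refine mem_distortionCone_of_real_smul hk ((isClosed_distortionCone K).mem_of_tendsto hlim
      (Filter.Eventually.of_forall fun R => smul_mem_distortionCone ?_ _))
    exact (hK n hn).fderiv_mem_distortionCone
      ((contDiff_affine_sq_add_const L e c).iterate_complex n) _
  have hmem' (n : ℕ) : (p • L) ^ n ∈ distortionCone K := by
    rcases Nat.eq_zero_or_pos n with rfl | hn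
    · have h1 : (1 : ℝ) ≤ K := (hK 1 le_rfl).1
      simpa [distortionCone, ContinuousLinearMap.det] using h1
    · exact hmem n hn
  have hscalar := eq_smul_of_forall_pow_mem_distortionCone (hdet ▸ hL) (by simp [hp1]) heig hmem'
  refine hconf ⟨t / p, fun z => ?_⟩
  have hz : p * L z = t * z := hscalar z
  field_simp
  linear_combination hz

theorem theorem2p6 (h : ℂ →ᵃ[ℝ] ℂ) (h_orient : 0 < LinearMap.det h.linear)
    (h_nonconf : ¬ Differentiable ℂ (h : ℂ → ℂ)) (c : ℂ) :
    IsQuasiregularOn (fun z : ℂ => h z ^ 2 + c) Set.univ ∧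
      ¬ IsUniformlyQuasiregular (fun z : ℂ => h z ^ 2 + c) := by
  let L : ℂ →L[ℝ] ℂ := LinearMap.toContinuousLinearMap h.linear
  have hz (z : ℂ) : h z = L z + h 0 := congrFun h.decomp z
  have hL : 0 < L.det := h_orient
  have hf : (fun z => h z ^ 2 + c) = fun z => (L z + h 0) ^ 2 + c :=
    funext fun z => by rw [hz z]
  rw [hf]
  refine ⟨isQuasiregularOn_affine_sq_add_const hL _ c,
    not_isUniformlyQuasiregular_affine_sq_add_const hL ?_ _ c⟩
  rintro ⟨a, ha⟩
  refine h_nonconf ?_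
  have : (h : ℂ → ℂ) = fun z => a * z + h 0 := funext fun z => by rw [hz z, ha]
  rw [this]
  fun_prop
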